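/- Let $A\in\mathbb{R}^{n\times n}$ be nonsingular and $B\in\mathbb{R}^{n\times 1}$ with $(A,B)$ controllable, i.e. any state of $\dot x(t)=Ax(t)+Bu(t)$ can be steered to any other state in some finite time by an integrable scalar control $u$. Let $N\ge 1$, let $0\le U_{\min}=U_1<U_2<\dots<U_N=1$ and $\mathbb{U}=\{\pm U_1,\dots,\pm U_N\}$, and let $w_1,\dots,w_N\in\mathbb{R}$ satisfy $w_1+\dots+w_N=1$ and $w_i>0$ for every $i<N$. Let $T>0$ and $\xi\in\mathbb{R}^n$. A measurable control $u:[0,T]\to\mathbb{R}$ is called feasible if $\|u\|_\infty=\operatorname{ess\,sup}_{t\in[0,T]}|u(t)|\le 1$ and the system with input $u$ has an absolutely continuous solution $x$ on $[0,T]$ (satisfying the equation almost everywhere) with $x(0)=\xi$ and $x(T)=0$. A SOAV (sum-of-absolute-values) optimal control is a feasible control that minimizes $$J(u)=\sum_{i=1}^N w_i\bigl(\|u-U_i\|_1+\|u+U_i\|_1\bigr),\qquad \|v\|_1=\int_0^T|v(t)|\,dt,$$ among all feasible controls. Then every SOAV optimal control $u^*$ satisfies (i) $u^*(t)\in\mathbb{U}$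 for almost all $t\in[0,T]$, or (ii) $\|u^*\|_\infty\le U_{\min}$. In particular, if $U_{\min}=0$, then $u^*(t)\in\mathbb{U}$ for almost all $t\in[0,T]$. -/

import Mathlib

open Set MeasureTheory
open scoped Matrix

noncomputable section

/-- `x` is a (Carathéodory) solution on `[0, T]` of the linear system `x' = A x + B u` with scalar
input `u`: `x` is absolutely continuous and satisfies the equation for almost every `t`. The input
matrix `B` has one column and is written as a vector. -/
def IsTrajectory {n : ℕ} (A : Matrix (Fin n) (Fin n) ℝ) (B : Fin n → ℝ) (T : ℝ)
    (u : ℝ → ℝ) (x : ℝ → Fin n → ℝ) : Prop :=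
  AbsolutelyContinuousOnInterval x 0 T ∧
    ∀ᵐ t ∂(volume.restrict (Icc 0 T)), HasDerivAt x (A *ᵥ x t + u t • B) t

/-- The pair `(A, B)` is controllable: any state can be steered to any other state in some finite
time by some integrable control. -/
def IsControllable {n : ℕ} (A : Matrix (Fin n) (Fin n) ℝ) (B : Fin n → ℝ) : Prop :=
  ∀ x₀ x₁ : Fin n → ℝ, ∃ τ : ℝ, 0 < τ ∧ ∃ (u : ℝ → ℝ) (x : ℝ → Fin n → ℝ),
    IntervalIntegrable u volume 0 τ ∧ IsTrajectory A B τ u x ∧ x 0 = x₀ ∧ x τ = x₁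

/-- The norm `‖u‖₁` on `[0, T]`. -/
def l1Norm (T : ℝ) (u : ℝ → ℝ) : ℝ :=
  ∫ t in (0 : ℝ)..T, |u t|

/-- The norm `‖u‖_∞`, the essential supremum of `|u|` over `[0, T]`. -/
def linftyNorm (T : ℝ) (u : ℝ → ℝ) : ENNReal :=
  eLpNorm u ⊤ (volume.restrict (Icc 0 T))

/-- The set of feasible controls: measurable controls on `[0, T]` with `‖u‖_∞ ≤ 1` that steer the
state from `ξ` at time `0` to the origin at time `T`. -/
def feasibleControls {n : ℕ} (A : Matrix (Fin n) (Fin n) ℝ) (B : Fin n → ℝ) (T : ℝ)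
    (ξ : Fin n → ℝ) : Set (ℝ → ℝ) :=
  {u | AEMeasurable u (volume.restrict (Icc 0 T)) ∧ linftyNorm T u ≤ 1 ∧
    ∃ x : ℝ → Fin n → ℝ, IsTrajectory A B T u x ∧ x 0 = ξ ∧ x T = 0}

/-- The alphabet `{±U_1, …, ±U_N}`. -/
def alphabet {N : ℕ} (U : Fin N → ℝ) : Set ℝ :=
  {v | ∃ i, v = U i ∨ v = -U i}

/-- The sum-of-absolute-values cost `J(u) = ∑ i, w_i (‖u - U_i‖₁ + ‖u + U_i‖₁)`. -/
def soavCost {N : ℕ} (U w : Fin N → ℝ) (T : ℝ) (u : ℝ → ℝ) : ℝ :=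
  ∑ i, w i * (l1Norm T (fun t => u t - U i) + l1Norm T (fun t => u t + U i))

/-- `u` is a SOAV optimal control for the initial state `ξ`: it is feasible and minimizes the cost
among all feasible controls. -/
def IsSOAVOptimal {n N : ℕ} (A : Matrix (Fin n) (Fin n) ℝ) (B : Fin n → ℝ) (U w : Fin N → ℝ)
    (T : ℝ) (ξ : Fin n → ℝ) (u : ℝ → ℝ) : Prop :=
  u ∈ feasibleControls A B T ξ ∧
    ∀ v ∈ feasibleControls A B T ξ, soavCost U w T u ≤ soavCost U w T v

end

/-! The proof perturbs an optimal control directly, with no adjoint equation and no separation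
theorem.

The final state reached by a control depends on it only through the moments
`∫ exp (-t A) B u t dt`. The components of the kernel `exp (-t A) B` and the constant function `1`
are linearly independent on every set of positive measure: a combination that vanishes there
vanishes everywhere by analyticity, its derivative then gives a covector `η ᵥ* A` annihilating the
kernel, and controllability together with `A.det ≠ 0` forces `η = 0`
(`eq_zero_of_dotProduct_inputKernel_add_const_eq_zero`). Since a Gram matrix of linearly independent
functions is invertible, bounded variations of the control living on a given set of positive measure
attain every displacement of the final state and, at the same time, every value of their integral
(`exists_variation`). Scaling makes them as small as needed.

The integrand of the cost is, on `[-1, 1]`, an even convex function that is affine between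
neighbouring points of the alphabet, constant for `|v| ≤ U 0` and strictly increasing in `|v|`
above. This has two consequences for an optimal control `u`.

* Where `u` is off the alphabet and `|u| > U 0`, the cost has one of finitely many nonzero slopes. On
  a set of positive measure with one fixed slope, a variation that keeps the final state and has
  integral of the opposite sign to the slope would lower the cost. So `u` lies in the alphabet almost
  everywhere on `{|u| > U 0}` (`IsSOAVOptimal.ae_mem_alphabet_of_lt`).
* If `{|u| < U 0}` has positive measure, variations on it cost nothing and can compensate for
  shrinking `u` on `{|u| > U 0}`, which strictly lowers the cost there unless this set is null. So
  `|u| ≤ U 0` almost everywhere (`IsSOAVOptimal.ae_abs_le`).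

If `{|u| < U 0}` is null, only the first point and the alphabet values `±U 0` remain. -/

/-! ### The flow of the uncontrolled system -/

/-- The flow `exp (t A)` of the uncontrolled system `x' = A x`, as a continuous linear map. The
exponential is taken in the Banach algebra of continuous linear maps, which, unlike the matrix
algebra, carries a global norm. -/
noncomputable def freeFlow {n : ℕ} (A : Matrix (Fin n) (Fin n) ℝ) (t : ℝ) :
    (Fin n → ℝ) →L[ℝ] (Fin n → ℝ) :=
  NormedSpace.exp (t • A.mulVecLin.toContinuousLinearMap)

/-- The kernel `exp (-t A) B`: its integral against a control over `[0, T]`, transported by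
`exp (T A)`, is the state that the control reaches from the origin. -/
noncomputable def inputKernel {n : ℕ} (A : Matrix (Fin n) (Fin n) ℝ) (B : Fin n → ℝ) (t : ℝ) :
    Fin n → ℝ :=
  freeFlow A (-t) B

section Flow

variable {n : ℕ} (A : Matrix (Fin n) (Fin n) ℝ) (B : Fin n → ℝ)

@[simp]
lemma freeFlow_zero : freeFlow A 0 = 1 := by
  simp [freeFlow]

lemma freeFlow_mul_freeFlow_neg (t : ℝ) : freeFlow A t * freeFlow A (-t) = 1 := by
  let := NormedAlgebra.restrictScalars ℚ ℝ ((Fin n → ℝ) →L[ℝ] (Fin n → ℝ))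
  unfold freeFlow
  rw [← NormedSpace.exp_add_of_commute (((Commute.refl _).smul_left _).smul_right _),
    ← add_smul, add_neg_cancel, zero_smul, NormedSpace.exp_zero]

lemma hasDerivAt_freeFlow (t : ℝ) :
    HasDerivAt (freeFlow A) (A.mulVecLin.toContinuousLinearMap * freeFlow A t) t :=
  hasDerivAt_exp_smul_const' A.mulVecLin.toContinuousLinearMap t

lemma hasDerivAt_freeFlow_neg (t : ℝ) :
    HasDerivAt (fun s => freeFlow A (-s))
      (-(freeFlow A (-t) * A.mulVecLin.toContinuousLinearMap)) t := by
  have h : HasDerivAt (freeFlow A) (freeFlow A (-t) * A.mulVecLin.toContinuousLinearMap) (-t) :=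
    hasDerivAt_exp_smul_const A.mulVecLin.toContinuousLinearMap (-t)
  simpa using! h.scomp t (hasDerivAt_neg t)

lemma hasDerivAt_inputKernel (t : ℝ) :
    HasDerivAt (inputKernel A B) (-(A *ᵥ inputKernel A B t)) t := by
  have h := ((hasDerivAt_freeFlow A (-t)).scomp t (hasDerivAt_neg t)).clm_apply
    (hasDerivAt_const t B)
  simpa [inputKernel] using! h

lemma analyticAt_freeFlow (t : ℝ) : AnalyticAt ℝ (freeFlow A) t := by
  have h := NormedSpace.exp_analytic (𝕂 := ℝ) (t • A.mulVecLin.toContinuousLinearMap)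
  exact h.fun_comp (f := fun s : ℝ => s • A.mulVecLin.toContinuousLinearMap) (by fun_prop)

lemma analyticAt_freeFlow_neg_apply (v : Fin n → ℝ) (t : ℝ) :
    AnalyticAt ℝ (fun s => freeFlow A (-s) v) t :=
  ((ContinuousLinearMap.apply ℝ (Fin n → ℝ) v).analyticAt _).fun_comp
    ((analyticAt_freeFlow A (-t)).fun_comp (f := fun s : ℝ => -s) (by fun_prop))

lemma contDiff_freeFlow_neg_apply (v : Fin n → ℝ) : ContDiff ℝ 1 fun s => freeFlow A (-s) v :=
  contDiff_iff_contDiffAt.2 fun t => (analyticAt_freeFlow_neg_apply A v t).contDiffAt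

lemma contDiff_freeFlow_apply (v : Fin n → ℝ) : ContDiff ℝ 1 fun s => freeFlow A s v := by
  simpa [Function.comp_def] using (contDiff_freeFlow_neg_apply A v).comp contDiff_neg

lemma analyticAt_inputKernel (t : ℝ) : AnalyticAt ℝ (inputKernel A B) t :=
  analyticAt_freeFlow_neg_apply A B t

lemma continuous_inputKernel : Continuous (inputKernel A B) :=
  continuous_iff_continuousAt.2 fun t => (analyticAt_inputKernel A B t).continuousAt

lemma analyticAt_dotProduct {f : ℝ → Fin n → ℝ} {t : ℝ} (η : Fin n → ℝ) (hf : AnalyticAt ℝ f t) :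
    AnalyticAt ℝ (fun s => η ⬝ᵥ f s) t := by
  rw [analyticAt_pi_iff] at hf
  exact Finset.univ.analyticAt_fun_sum fun i _ => analyticAt_const.mul (hf i)

lemma HasDerivAt.const_dotProduct {f : ℝ → Fin n → ℝ} {f' : Fin n → ℝ} {t : ℝ} (η : Fin n → ℝ)
    (hf : HasDerivAt f f' t) : HasDerivAt (fun s => η ⬝ᵥ f s) (η ⬝ᵥ f') t := by
  rw [hasDerivAt_pi] at hf
  exact HasDerivAt.fun_sum fun i _ => (hf i).const_mul (η i)

end Flow

/-! ### Controllability and linear independence of the kernel -/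

lemma AbsolutelyContinuousOnInterval.apply {n : ℕ} {x : ℝ → Fin n → ℝ} {a b : ℝ}
    (hx : AbsolutelyContinuousOnInterval x a b) (j : Fin n) :
    AbsolutelyContinuousOnInterval (fun t => x t j) a b := by
  rw [absolutelyContinuousOnInterval_iff] at hx ⊢
  intro ε hε
  obtain ⟨δ, hδ, h⟩ := hx ε hε
  exact ⟨δ, hδ, fun E hE hE' =>
    (Finset.sum_le_sum fun i _ => dist_le_pi_dist _ _ j).trans_lt (h E hE hE')⟩

lemma AbsolutelyContinuousOnInterval.finset_sum {ι : Type*} (s : Finset ι) {E : Type*}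
    [NormedAddCommGroup E] [NormedSpace ℝ E] {f : ι → ℝ → E} {a b : ℝ}
    (hf : ∀ i ∈ s, AbsolutelyContinuousOnInterval (f i) a b) :
    AbsolutelyContinuousOnInterval (fun t => ∑ i ∈ s, f i t) a b := by
  classical
  induction s using Finset.induction_on with
  | empty =>
    simpa using (contDiff_const (c := (0 : E))).contDiffOn.absolutelyContinuousOnInterval
  | insert i s hi ih =>
    simp only [Finset.sum_insert hi]
    exact (hf i (by simp)).fun_add (ih fun j hj => hf j (by simp [hj]))

lemma AbsolutelyContinuousOnInterval.clm_apply {n : ℕ}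
    {G : ℝ → (Fin n → ℝ) →L[ℝ] (Fin n → ℝ)} {x : ℝ → Fin n → ℝ} {a b : ℝ}
    (hG : ∀ v, ContDiff ℝ 1 fun t => G t v)
    (hx : ∀ j, AbsolutelyContinuousOnInterval (fun t => x t j) a b) :
    AbsolutelyContinuousOnInterval (fun t => G t (x t)) a b := by
  have hsum : (fun t => G t (x t)) = fun t => ∑ j, x t j • G t (Pi.single j 1) := by
    ext1 t
    conv_lhs => rw [pi_eq_sum_univ' (x t)]
    simp only [map_sum, map_smul]
  rw [hsum]
  exact AbsolutelyContinuousOnInterval.finset_sum _ fun j _ =>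
    (hx j).fun_smul (hG _).contDiffOn.absolutelyContinuousOnInterval

/-- Along any trajectory, a covector that annihilates the kernel pairs with `exp (-t A) x t` to a
constant, since the derivative `(η ⬝ᵥ exp (-t A) B) u t` of the pairing vanishes. Steering `η`
itself to the origin then forces `η ⬝ᵥ η = 0`. -/
lemma eq_zero_of_dotProduct_inputKernel_eq_zero {n : ℕ} {A : Matrix (Fin n) (Fin n) ℝ}
    {B : Fin n → ℝ} (hAB : IsControllable A B) {η : Fin n → ℝ}
    (h : ∀ t, η ⬝ᵥ inputKernel A B t = 0) : η = 0 := by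
  obtain ⟨τ, hτ, u, x, -, ⟨hac, hx⟩, hx0, hx1⟩ := hAB η 0
  have hF : AbsolutelyContinuousOnInterval (fun t => η ⬝ᵥ freeFlow A (-t) (x t)) 0 τ :=
    AbsolutelyContinuousOnInterval.finset_sum _ fun j _ =>
      ((AbsolutelyContinuousOnInterval.clm_apply (contDiff_freeFlow_neg_apply A)
        hac.apply).apply j).const_mul (η j)
  have hderiv : ∀ᵐ t, t ∈ uIcc 0 τ → HasDerivAt (fun t => η ⬝ᵥ freeFlow A (-t) (x t)) 0 t := by
    rw [uIcc_of_le hτ.le]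
    rw [ae_restrict_iff' measurableSet_Icc] at hx
    filter_upwards [hx] with t ht hmem
    have h1 := ((hasDerivAt_freeFlow_neg A t).clm_apply (ht hmem)).const_dotProduct η
    have h2 := h t
    simp only [inputKernel] at h2
    simpa [dotProduct_add, dotProduct_smul, h2] using h1
  obtain ⟨C, hC⟩ := hF.const_of_ae_hasDerivAt_zero hderiv
  have h0 := hC 0 left_mem_uIcc
  have h1 := hC τ right_mem_uIcc
  simp only [hx0, hx1, neg_zero, freeFlow_zero, map_zero, dotProduct_zero,
    one_apply_eq_self] at h0 h1
  exact dotProduct_self_eq_zero.1 (h0.trans h1.symm)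

/-- An analytic function on the line whose zeros have positive measure vanishes identically. -/
lemma eq_zero_of_analyticAt_of_ae {F : ℝ → ℝ} (hF : ∀ t, AnalyticAt ℝ F t) {s : Set ℝ}
    {p : ℝ → Prop} (hp : ¬ ∀ᵐ t ∂(volume.restrict s), ¬ p t)
    (h : ∀ᵐ t ∂(volume.restrict s), p t → F t = 0) (t : ℝ) : F t = 0 := by
  by_contra ht
  have hcod := AnalyticOnNhd.preimage_zero_mem_codiscrete (fun t _ => hF t) ht
  have hae : ∀ᵐ t, F t ≠ 0 := by
    simpa using! ae_restrict_le_codiscreteWithin (μ := (volume : Measure ℝ)) MeasurableSet.univ hcod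
  apply hp
  filter_upwards [h, ae_restrict_of_ae hae] with r hr hr' hpr using hr' (hr hpr)

/-- The components of the kernel together with the constant function `1` are linearly independent
on every set of positive measure. Invertibility of `A` is needed to separate off the constants:
differentiating `η ⬝ᵥ exp (-t A) B = -c` shows that `η ᵥ* A` annihilates the kernel. -/
lemma eq_zero_of_dotProduct_inputKernel_add_const_eq_zero {n : ℕ} {A : Matrix (Fin n) (Fin n) ℝ}
    {B : Fin n → ℝ} (hA : A.det ≠ 0) (hAB : IsControllable A B) {s : Set ℝ} {p : ℝ → Prop}
    (hp : ¬ ∀ᵐ t ∂(volume.restrict s), ¬ p t) {η : Fin n → ℝ} {c : ℝ}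
    (h : ∀ᵐ t ∂(volume.restrict s), p t → η ⬝ᵥ inputKernel A B t + c = 0) : η = 0 ∧ c = 0 := by
  have hz := eq_zero_of_analyticAt_of_ae (F := fun t => η ⬝ᵥ inputKernel A B t + c)
    (fun t => (analyticAt_dotProduct η (analyticAt_inputKernel A B t)).add analyticAt_const) hp h
  have hη : η = 0 := by
    refine Matrix.eq_zero_of_vecMul_eq_zero hA
      (eq_zero_of_dotProduct_inputKernel_eq_zero hAB fun t => ?_)
    have h1 := ((hasDerivAt_inputKernel A B t).const_dotProduct η).add_const c
    have h2 : HasDerivAt (fun t => η ⬝ᵥ inputKernel A B t + c) 0 t := by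
      simpa only [hz] using hasDerivAt_const t (0 : ℝ)
    have h3 := h1.unique h2
    rwa [dotProduct_neg, neg_eq_zero, Matrix.dotProduct_mulVec] at h3
  exact ⟨hη, by simpa [hη] using hz 0⟩

/-! ### Moment problems with a weight -/

/-- If the functions `f i` are linearly independent where the weight `d` is positive, their Gram
matrix with respect to `d` is injective, so every moment vector is attained by the product of `d`
with a combination of the `f i`. -/
lemma exists_weighted_moments {Ω ι : Type*} [MeasurableSpace Ω] [Fintype ι] {μ : Measure Ω}
    {f : ι → Ω → ℝ} {d : Ω → ℝ} (hd : ∀ t, 0 ≤ d t)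
    (hint : ∀ i j, Integrable (fun t => f i t * (d t * f j t)) μ)
    (hind : ∀ c : ι → ℝ, (∀ᵐ t ∂μ, d t ≠ 0 → ∑ i, c i * f i t = 0) → c = 0) (y : ι → ℝ) :
    ∃ c : ι → ℝ, ∀ i, ∫ t, f i t * (d t * ∑ j, c j * f j t) ∂μ = y i := by
  have hint' (c : ι → ℝ) (i : ι) : Integrable (fun t => f i t * (d t * ∑ j, c j * f j t)) μ := by
    have h := integrable_finsetSum Finset.univ fun j _ => (hint i j).const_mul (c j)
    refine h.congr (ae_of_all _ fun t => ?_)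
    simp only [Finset.mul_sum]
    exact Finset.sum_congr rfl fun j _ => by ring
  let G : (ι → ℝ) →ₗ[ℝ] (ι → ℝ) :=
    { toFun := fun c i => ∫ t, f i t * (d t * ∑ j, c j * f j t) ∂μ
      map_add' := fun c c' => by
        ext i
        simp only [Pi.add_apply]
        rw [← integral_add (hint' c i) (hint' c' i)]
        refine integral_congr_ae (ae_of_all _ fun t => ?_)
        simp only [add_mul, Finset.sum_add_distrib]
        ring
      map_smul' := fun r c => by
        ext i
        simp only [Pi.smul_apply, smul_eq_mul, RingHom.id_apply]
        rw [← integral_const_mul]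
        refine integral_congr_ae (ae_of_all _ fun t => ?_)
        simp only [mul_assoc r, ← Finset.mul_sum]
        ring }
  have hG : Function.Injective G := by
    rw [← LinearMap.ker_eq_bot, LinearMap.ker_eq_bot']
    intro c hc
    apply hind
    have hsum : ∀ t, ∑ i, c i * (f i t * (d t * ∑ j, c j * f j t)) =
        d t * (∑ j, c j * f j t) ^ 2 := by
      intro t
      simp only [← mul_assoc, ← Finset.sum_mul]
      ring
    have hq : ∫ t, d t * (∑ j, c j * f j t) ^ 2 ∂μ = 0 := by
      simp only [← hsum]
      rw [integral_finsetSum _ fun i _ => (hint' c i).const_mul (c i)]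
      refine Finset.sum_eq_zero fun i _ => ?_
      rw [integral_const_mul]
      exact mul_eq_zero_of_right _ (congrFun hc i)
    rw [integral_eq_zero_iff_of_nonneg (fun t => mul_nonneg (hd t) (sq_nonneg _))] at hq
    · filter_upwards [hq] with t ht hdt
      simpa [hdt] using ht
    · simp only [← hsum]
      exact integrable_finsetSum _ fun i _ => (hint' c i).const_mul (c i)
  obtain ⟨c, hc⟩ := LinearMap.injective_iff_surjective.1 hG y
  exact ⟨c, fun i => congrFun hc i⟩

lemma exists_abs_le_of_continuous {f : ℝ → ℝ} (hf : Continuous f) (T : ℝ) :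
    ∃ C, ∀ t ∈ Icc 0 T, |f t| ≤ C :=
  isCompact_Icc.exists_bound_of_continuousOn hf.continuousOn

/-- Any prescribed displacement of the final state, together with any prescribed integral, is
produced by a variation `h` of the control that is dominated by a multiple of the weight `d`. In
particular `h` vanishes wherever `d` does. -/
lemma exists_variation {n : ℕ} {A : Matrix (Fin n) (Fin n) ℝ} {B : Fin n → ℝ} (hA : A.det ≠ 0)
    (hAB : IsControllable A B) {T : ℝ} {d : ℝ → ℝ} (hd : ∀ t, 0 ≤ d t)
    (hdi : Integrable d (volume.restrict (Icc 0 T)))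
    (hd0 : ¬ ∀ᵐ t ∂(volume.restrict (Icc 0 T)), ¬ d t ≠ 0) (y : Fin n → ℝ) (r : ℝ) :
    ∃ h : ℝ → ℝ, AEMeasurable h (volume.restrict (Icc 0 T)) ∧
      (∃ C, ∀ t ∈ Icc 0 T, |h t| ≤ C * d t) ∧
      (∀ i, ∫ t in Icc 0 T, inputKernel A B t i * h t = y i) ∧ ∫ t in Icc 0 T, h t = r := by
  let f : Option (Fin n) → ℝ → ℝ := fun o t => o.elim 1 (inputKernel A B t)
  have hf : ∀ o, Continuous (f o) := by
    rintro (_ | i)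
    · exact continuous_const
    · exact (continuous_apply i).comp (continuous_inputKernel A B)
  have hint : ∀ i j, Integrable (fun t => f i t * (d t * f j t)) (volume.restrict (Icc 0 T)) := by
    intro i j
    obtain ⟨C, hC⟩ := exists_abs_le_of_continuous ((hf i).mul (hf j)) T
    refine (hdi.bdd_mul (c := C) ((hf i).mul (hf j)).aestronglyMeasurable ?_).congr
      (ae_of_all _ fun t => ?_)
    · exact (ae_restrict_iff' measurableSet_Icc).2 (ae_of_all _ hC)
    · simp only [Pi.mul_apply]
      ring
  obtain ⟨c, hc⟩ := exists_weighted_moments hd hint (fun c hc => by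
    obtain ⟨h1, h2⟩ := eq_zero_of_dotProduct_inputKernel_add_const_eq_zero hA hAB hd0
      (η := fun i => c (some i)) (c := c none) (by
        filter_upwards [hc] with t ht hdt
        have := ht hdt
        simp only [f, Fintype.sum_option, Option.elim] at this
        simpa [dotProduct, add_comm] using this)
    ext (_ | i)
    · exact h2
    · exact congrFun h1 i) (fun o => o.elim r y)
  have hg : Continuous fun t => ∑ j, c j * f j t := by fun_prop
  obtain ⟨C, hC⟩ := exists_abs_le_of_continuous hg T
  refine ⟨fun t => d t * ∑ j, c j * f j t, hdi.aemeasurable.mul hg.aemeasurable, ⟨C, fun t ht => ?_⟩,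
    fun i => hc (some i), by simpa [f] using hc none⟩
  rw [abs_mul, abs_of_nonneg (hd t), mul_comm]
  exact mul_le_mul_of_nonneg_right (hC t ht) (hd t)

/-! ### Feasible variations -/

lemma linftyNorm_le_ofReal {T : ℝ} {u : ℝ → ℝ} {c : ℝ}
    (h : ∀ᵐ t ∂(volume.restrict (Icc 0 T)), |u t| ≤ c) : linftyNorm T u ≤ ENNReal.ofReal c := by
  rw [linftyNorm, eLpNorm_exponent_top]
  refine eLpNormEssSup_le_of_ae_enorm_bound ?_
  filter_upwards [h] with t ht
  rw [← ofReal_norm]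
  exact ENNReal.ofReal_le_ofReal ht

lemma ae_abs_le_one_of_linftyNorm_le {T : ℝ} {u : ℝ → ℝ} (h : linftyNorm T u ≤ 1) :
    ∀ᵐ t ∂(volume.restrict (Icc 0 T)), |u t| ≤ 1 := by
  rw [linftyNorm, eLpNorm_exponent_top] at h
  filter_upwards [ae_le_eLpNormEssSup (f := u)] with t ht
  have := ht.trans h
  rw [← ofReal_norm] at this
  simpa using this

/-- Adding to a feasible control a bounded variation that does not displace the final state keeps
it feasible, as long as the constraint `|u| ≤ 1` survives. The new trajectory is obtained by adding
`exp (t A) ∫₀ᵗ k s exp (-s A) B ds`. -/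
lemma add_mem_feasibleControls {n : ℕ} {A : Matrix (Fin n) (Fin n) ℝ} {B : Fin n → ℝ} {T : ℝ}
    (hT : 0 ≤ T) {ξ : Fin n → ℝ} {u k : ℝ → ℝ} (hu : u ∈ feasibleControls A B T ξ)
    (hk : AEMeasurable k (volume.restrict (Icc 0 T))) {C : ℝ}
    (hkC : ∀ᵐ t ∂(volume.restrict (Icc 0 T)), |k t| ≤ C)
    (hk0 : ∀ i, ∫ t in Icc 0 T, inputKernel A B t i * k t = 0)
    (huk : ∀ᵐ t ∂(volume.restrict (Icc 0 T)), |u t + k t| ≤ 1) :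
    (fun t => u t + k t) ∈ feasibleControls A B T ξ := by
  obtain ⟨hum, -, x, ⟨hxac, hx⟩, hx0, hxT⟩ := hu
  refine ⟨hum.add hk, by simpa using linftyNorm_le_ofReal huk, ?_⟩
  have hqi (i : Fin n) : IntegrableOn (fun t => inputKernel A B t i * k t) (Icc 0 T) :=
    IntegrableOn.continuousOn_mul
      ((continuous_apply i).comp (continuous_inputKernel A B)).continuousOn
      (Integrable.of_bound hk.aestronglyMeasurable C hkC) isCompact_Icc
  have hqii (i : Fin n) : IntervalIntegrable (fun t => inputKernel A B t i * k t) volume 0 T :=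
    (intervalIntegrable_iff_integrableOn_Icc_of_le hT).2 (hqi i)
  set z : ℝ → Fin n → ℝ := fun t i => ∫ s in (0 : ℝ)..t, inputKernel A B s i * k s with hz
  have hz0 : z 0 = 0 := by
    ext i
    simp [hz]
  have hzT : z T = 0 := by
    ext i
    simp only [hz, intervalIntegral.integral_of_le hT, ← integral_Icc_eq_integral_Ioc]
    exact hk0 i
  have hzac (i : Fin n) : AbsolutelyContinuousOnInterval (fun t => z t i) 0 T :=
    (hqii i).absolutelyContinuousOnInterval_intervalIntegral left_mem_uIcc
  refine ⟨fun t => x t + freeFlow A t (z t),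
    ⟨hxac.fun_add (.clm_apply (contDiff_freeFlow_apply A) hzac), ?_⟩,
    by simp [hx0, hz0], by simp [hxT, hzT]⟩
  have hz' := ae_all_iff.2 fun i => (hqii i).ae_hasDerivAt_integral
  rw [ae_restrict_iff' measurableSet_Icc] at hx ⊢
  filter_upwards [hx, hz'] with t ht hzt hmem
  have h1 : HasDerivAt z (k t • inputKernel A B t) t := by
    refine hasDerivAt_pi.2 fun i => ?_
    rw [Pi.smul_apply, smul_eq_mul, mul_comm]
    exact hzt i (by rwa [uIcc_of_le hT]) 0 left_mem_uIcc
  refine ((ht hmem).fun_add ((hasDerivAt_freeFlow A t).clm_apply h1)).congr_deriv ?_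
  have h2 : freeFlow A t (inputKernel A B t) = B :=
    congrArg (fun f => f B) (freeFlow_mul_freeFlow_neg A t)
  simp only [map_smul, h2]
  simp [Matrix.mulVec_add, add_smul]
  abel

/-! ### The running cost -/

/-- The integrand of the cost, as a function of the value of the control. -/
noncomputable def runningCost {N : ℕ} (U w : Fin N → ℝ) (v : ℝ) : ℝ :=
  ∑ i, w i * (|v - U i| + |v + U i|)

/-- The slope of the running cost at a value outside the alphabet. -/
noncomputable def runningCostSlope {N : ℕ} (U w : Fin N → ℝ) (v : ℝ) : ℝ :=
  ∑ i, w i * ((SignType.sign (v - U i) : ℝ) + (SignType.sign (v + U i) : ℝ))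

lemma continuous_runningCost {N : ℕ} (U w : Fin N → ℝ) : Continuous (runningCost U w) := by
  unfold runningCost
  fun_prop

lemma measurable_runningCostSlope {N : ℕ} (U w : Fin N → ℝ) :
    Measurable (runningCostSlope U w) := by
  have hs : Measurable (fun x : ℝ => ((SignType.sign x : SignType) : ℝ)) := by
    have h : (fun x : ℝ => ((SignType.sign x : SignType) : ℝ)) =
        fun x => if 0 < x then 1 else if x < 0 then -1 else 0 := by
      ext x
      rw [sign_apply]
      split_ifs <;> simp
    rw [h]
    exact Measurable.ite measurableSet_Ioi measurable_const
      (Measurable.ite measurableSet_Iio measurable_const measurable_const)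
  unfold runningCostSlope
  exact Finset.measurable_fun_sum _ fun i _ => measurable_const.mul
    ((hs.comp (measurable_id.sub_const _)).add (hs.comp (measurable_id.add_const _)))

lemma finite_range_runningCostSlope {N : ℕ} (U w : Fin N → ℝ) :
    (range (runningCostSlope U w)).Finite := by
  refine (finite_range fun σ : Fin N → SignType × SignType =>
    ∑ i, w i * (((σ i).1 : ℝ) + ((σ i).2 : ℝ))).subset ?_
  rintro _ ⟨v, rfl⟩
  exact ⟨fun i => (SignType.sign (v - U i), SignType.sign (v + U i)), rfl⟩

lemma finite_alphabet {N : ℕ} (U : Fin N → ℝ) : (alphabet U).Finite := by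
  refine ((finite_range U).union (finite_range fun i => -U i)).subset ?_
  rintro v ⟨i, rfl | rfl⟩
  · exact Or.inl ⟨i, rfl⟩
  · exact Or.inr ⟨i, rfl⟩

lemma infDist_alphabet_le {N : ℕ} {U : Fin N → ℝ} (v : ℝ) (i : Fin N) :
    Metric.infDist v (alphabet U) ≤ |v - U i| ∧ Metric.infDist v (alphabet U) ≤ |v + U i| := by
  refine ⟨Metric.infDist_le_dist_of_mem ⟨i, Or.inl rfl⟩, ?_⟩
  simpa [Real.dist_eq] using
    Metric.infDist_le_dist_of_mem (x := v) (show -U i ∈ alphabet U from ⟨i, Or.inr rfl⟩)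

lemma abs_add_eq_abs_add_sign_mul {x y : ℝ} (h : |y| ≤ |x|) :
    |x + y| = |x| + (SignType.sign x : ℝ) * y := by
  rcases lt_trichotomy x 0 with hx | rfl | hx
  · rw [abs_of_neg hx] at h ⊢
    rw [abs_of_nonpos (by linarith [le_abs_self y]), sign_neg hx]
    simp
    ring
  · simpa using h
  · rw [abs_of_pos hx] at h ⊢
    rw [abs_of_nonneg (by linarith [neg_abs_le y]), sign_pos hx]
    simp

/-- The running cost is affine as long as the value does not cross the alphabet. -/
lemma runningCost_add {N : ℕ} {U w : Fin N → ℝ} {v y : ℝ}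
    (h : |y| ≤ Metric.infDist v (alphabet U)) :
    runningCost U w (v + y) = runningCost U w v + runningCostSlope U w v * y := by
  simp only [runningCost, runningCostSlope, Finset.sum_mul, ← Finset.sum_add_distrib]
  refine Finset.sum_congr rfl fun i _ => ?_
  obtain ⟨h1, h2⟩ := infDist_alphabet_le (U := U) v i
  rw [show v + y - U i = (v - U i) + y by ring, show v + y + U i = (v + U i) + y by ring,
    abs_add_eq_abs_add_sign_mul (h.trans h1), abs_add_eq_abs_add_sign_mul (h.trans h2)]
  ring

lemma abs_sub_add_abs_add {v c : ℝ} (hc : 0 ≤ c) : |v - c| + |v + c| = 2 * max |v| c := by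
  rcases le_total |v| c with h | h
  · rw [max_eq_right h]
    obtain ⟨h1, h2⟩ := abs_le.1 h
    rw [abs_of_nonpos (by linarith), abs_of_nonneg (by linarith)]
    ring
  · rw [max_eq_left h]
    rcases abs_cases v with ⟨hv, h0⟩ | ⟨hv, h0⟩
    · rw [hv] at h ⊢
      rw [abs_of_nonneg (by linarith), abs_of_nonneg (by linarith)]
      ring
    · rw [hv] at h ⊢
      rw [abs_of_nonpos (by linarith), abs_of_nonpos (by linarith)]
      ring

section Levels

variable {m : ℕ} {U w : Fin (m + 1) → ℝ}

lemma runningCost_eq_sum_max (hU : ∀ i, 0 ≤ U i) (v : ℝ) :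
    runningCost U w v = ∑ i, w i * (2 * max |v| (U i)) :=
  Finset.sum_congr rfl fun i _ => by rw [abs_sub_add_abs_add (hU i)]

/-- The weight of the last level `1` is irrelevant on `[-1, 1]`, where its term is constant; all
other terms are monotone in `|v|`. -/
lemma runningCost_le_runningCost (hU : ∀ i, 0 ≤ U i) (hU_last : U (Fin.last m) = 1)
    (hw_pos : ∀ i, i ≠ Fin.last m → 0 < w i) {a b : ℝ} (hab : |a| ≤ |b|) (hb : |b| ≤ 1) :
    runningCost U w a ≤ runningCost U w b := by
  rw [runningCost_eq_sum_max hU, runningCost_eq_sum_max hU]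
  refine Finset.sum_le_sum fun i _ => ?_
  by_cases hi : i = Fin.last m
  · rw [hi, hU_last, max_eq_right hb, max_eq_right (hab.trans hb)]
  · have := (hw_pos i hi).le
    gcongr

lemma runningCost_lt_runningCost (hU : ∀ i, 0 ≤ U i) (hU_last : U (Fin.last m) = 1)
    (hw_pos : ∀ i, i ≠ Fin.last m → 0 < w i) {a b : ℝ} (hab : |a| < |b|) (hb : |b| ≤ 1)
    (hb0 : U 0 < |b|) : runningCost U w a < runningCost U w b := by
  rw [runningCost_eq_sum_max hU, runningCost_eq_sum_max hU]
  refine Finset.sum_lt_sum (fun i _ => ?_) ⟨0, Finset.mem_univ _, ?_⟩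
  · by_cases hi : i = Fin.last m
    · rw [hi, hU_last, max_eq_right hb, max_eq_right (hab.le.trans hb)]
    · have := (hw_pos i hi).le
      gcongr
  · have h0 : (0 : Fin (m + 1)) ≠ Fin.last m := fun h => by
      rw [h, hU_last] at hb0
      linarith
    have := hw_pos 0 h0
    have hmax : max |a| (U 0) < max |b| (U 0) := by
      rw [max_eq_left hb0.le]
      exact max_lt hab hb0
    gcongr

lemma runningCost_eq_runningCost_of_abs_le (hU_mono : StrictMono U) (hU_nonneg : 0 ≤ U 0)
    {a b : ℝ} (ha : |a| ≤ U 0) (hb : |b| ≤ U 0) : runningCost U w a = runningCost U w b := by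
  have h0 (i : Fin (m + 1)) : U 0 ≤ U i := hU_mono.monotone (Fin.zero_le i)
  have hU (i : Fin (m + 1)) : 0 ≤ U i := hU_nonneg.trans (h0 i)
  rw [runningCost_eq_sum_max hU, runningCost_eq_sum_max hU]
  refine Finset.sum_congr rfl fun i _ => ?_
  rw [max_eq_right (ha.trans (h0 i)), max_eq_right (hb.trans (h0 i))]

/-- Off the alphabet and above the lowest level the running cost has nonzero slope: moving a little
towards the origin decreases it strictly. -/
lemma runningCostSlope_ne_zero (hU : ∀ i, 0 ≤ U i) (hU_last : U (Fin.last m) = 1)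
    (hw_pos : ∀ i, i ≠ Fin.last m → 0 < w i) {v : ℝ} (hv : v ∉ alphabet U) (hv1 : |v| ≤ 1)
    (hv0 : U 0 < |v|) : runningCostSlope U w v ≠ 0 := by
  intro hs
  have hpos : 0 < Metric.infDist v (alphabet U) :=
    ((finite_alphabet U).isClosed.notMem_iff_infDist_pos ⟨U 0, 0, Or.inl rfl⟩).1 hv
  have hvpos : 0 < |v| := (hU 0).trans_lt hv0
  set δ := min 1 (Metric.infDist v (alphabet U)) with hδ
  have hδ0 : 0 < δ := lt_min one_pos hpos
  have hδ1 : δ ≤ 1 := min_le_left _ _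
  have h1 : runningCost U w (v + -(δ * v)) = runningCost U w v := by
    rw [runningCost_add, hs, zero_mul, add_zero]
    rw [abs_neg, abs_mul, abs_of_pos hδ0]
    exact (mul_le_of_le_one_right hδ0.le hv1).trans (min_le_right _ _)
  refine (runningCost_lt_runningCost (a := v + -(δ * v)) hU hU_last hw_pos ?_ hv1 hv0).ne h1
  rw [show v + -(δ * v) = (1 - δ) * v by ring, abs_mul, abs_of_nonneg (by linarith)]
  nlinarith

end Levels

lemma integrable_runningCost {N : ℕ} {U w : Fin N → ℝ} {T : ℝ} {u : ℝ → ℝ}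
    (hu : AEMeasurable u (volume.restrict (Icc 0 T)))
    (hu1 : ∀ᵐ t ∂(volume.restrict (Icc 0 T)), |u t| ≤ 1) :
    Integrable (fun t => runningCost U w (u t)) (volume.restrict (Icc 0 T)) := by
  obtain ⟨C, hC⟩ := (isCompact_Icc (a := (-1 : ℝ)) (b := 1)).exists_bound_of_continuousOn
    (continuous_runningCost U w).continuousOn
  refine Integrable.of_bound
    ((continuous_runningCost U w).measurable.comp_aemeasurable hu).aestronglyMeasurable C ?_
  filter_upwards [hu1] with t ht using hC _ (abs_le.1 ht)

lemma soavCost_eq_integral {N : ℕ} {U w : Fin N → ℝ} {T : ℝ} (hT : 0 ≤ T) {u : ℝ → ℝ}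
    (hu : AEMeasurable u (volume.restrict (Icc 0 T)))
    (hu1 : ∀ᵐ t ∂(volume.restrict (Icc 0 T)), |u t| ≤ 1) :
    soavCost U w T u = ∫ t in Icc 0 T, runningCost U w (u t) := by
  have hi (c : ℝ) : Integrable (fun t => |u t + c|) (volume.restrict (Icc 0 T)) :=
    ((Integrable.of_bound hu.aestronglyMeasurable 1 hu1).add (integrable_const c)).abs
  have hi' (c : ℝ) : Integrable (fun t => |u t - c|) (volume.restrict (Icc 0 T)) := by
    simpa [sub_eq_add_neg] using hi (-c)
  simp only [soavCost, l1Norm, runningCost, intervalIntegral.integral_of_le hT,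
    ← integral_Icc_eq_integral_Ioc]
  rw [integral_finsetSum _ fun i _ => ((hi' (U i)).fun_add (hi (U i))).const_mul (w i)]
  refine Finset.sum_congr rfl fun i _ => ?_
  rw [integral_const_mul, integral_add (hi' (U i)) (hi (U i))]

/-! ### Variations of an optimal control -/

section Optimal

variable {n m : ℕ} {A : Matrix (Fin n) (Fin n) ℝ} {B : Fin n → ℝ} {U w : Fin (m + 1) → ℝ}
  {T : ℝ} {ξ : Fin n → ℝ} {u : ℝ → ℝ}

lemma IsSOAVOptimal.integral_runningCost_le (hT : 0 ≤ T) (hu : IsSOAVOptimal A B U w T ξ u)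
    {k : ℝ → ℝ} (hk : AEMeasurable k (volume.restrict (Icc 0 T))) {C : ℝ}
    (hkC : ∀ᵐ t ∂(volume.restrict (Icc 0 T)), |k t| ≤ C)
    (hk0 : ∀ i, ∫ t in Icc 0 T, inputKernel A B t i * k t = 0)
    (huk : ∀ᵐ t ∂(volume.restrict (Icc 0 T)), |u t + k t| ≤ 1) :
    ∫ t in Icc 0 T, runningCost U w (u t) ≤ ∫ t in Icc 0 T, runningCost U w (u t + k t) := by
  have h := hu.2 _ (add_mem_feasibleControls hT hu.1 hk hkC hk0 huk)
  rwa [soavCost_eq_integral hT hu.1.1 (ae_abs_le_one_of_linftyNorm_le hu.1.2.1),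
    soavCost_eq_integral hT (hu.1.1.fun_add hk) huk] at h

/-- Where the slope of the running cost has a fixed nonzero value `s` and the control avoids the
alphabet, the cost is affine in small variations. If this happened on a set of positive measure, a
variation living there could keep the final state and have an integral of sign opposite to `s`,
lowering the cost. -/
lemma IsSOAVOptimal.ae_mem_alphabet_of_slope_eq (hA : A.det ≠ 0) (hAB : IsControllable A B)
    (hU_last : U (Fin.last m) = 1) (hT : 0 ≤ T) (hu : IsSOAVOptimal A B U w T ξ u) {s : ℝ}
    (hs : s ≠ 0) :
    ∀ᵐ t ∂(volume.restrict (Icc 0 T)), runningCostSlope U w (u t) = s → u t ∈ alphabet U := by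
  have hum := hu.1.1
  have hu1 := ae_abs_le_one_of_linftyNorm_le hu.1.2.1
  have hle (v : ℝ) (hv : |v| ≤ 1) : Metric.infDist v (alphabet U) ≤ 1 - |v| := by
    obtain ⟨h1, h2⟩ := infDist_alphabet_le (U := U) v (Fin.last m)
    rw [hU_last] at h1 h2
    obtain ⟨h3, h4⟩ := abs_le.1 hv
    rw [abs_of_nonpos (by linarith)] at h1
    rw [abs_of_nonneg (by linarith)] at h2
    rcases abs_cases v with h | h <;> linarith
  by_contra hcon
  -- The weight is the distance to the alphabet, restricted to where the slope is `s`.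
  set δ : ℝ → ℝ := {v | runningCostSlope U w v = s}.indicator
    (fun v => Metric.infDist v (alphabet U)) with hδ
  have hδm : Measurable δ := (Metric.continuous_infDist_pt _).measurable.indicator
    (measurable_runningCostSlope U w (measurableSet_singleton s))
  have hδ0 (v : ℝ) : 0 ≤ δ v := indicator_nonneg (fun _ _ => Metric.infDist_nonneg) v
  have hδle (v : ℝ) : δ v ≤ Metric.infDist v (alphabet U) :=
    indicator_le_self' (fun _ _ => Metric.infDist_nonneg) v
  have hdi : Integrable (fun t => δ (u t)) (volume.restrict (Icc 0 T)) := by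
    refine Integrable.of_bound (hδm.comp_aemeasurable hum).aestronglyMeasurable 1 ?_
    filter_upwards [hu1] with t ht
    rw [Real.norm_of_nonneg (hδ0 _)]
    linarith [hδle (u t), hle _ ht, abs_nonneg (u t)]
  have hd0 : ¬ ∀ᵐ t ∂(volume.restrict (Icc 0 T)), ¬ δ (u t) ≠ 0 := by
    refine fun h => hcon (h.mono fun t ht hst => ?_)
    rw [not_not, hδ, indicator_of_mem (by exact hst)] at ht
    exact ((finite_alphabet U).isClosed.mem_iff_infDist_zero ⟨U 0, 0, Or.inl rfl⟩).2 ht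
  obtain ⟨h, hm, ⟨C, hC⟩, hh0, hhs⟩ := exists_variation hA hAB (fun t => hδ0 (u t)) hdi hd0 0 (-s)
  -- Scaling by `ε` brings `h` below the weight, hence below the distance to the alphabet.
  set ε : ℝ := (max C 1)⁻¹ with hε
  have hmax : 0 < max C 1 := lt_max_of_lt_right one_pos
  have hε0 : 0 < ε := inv_pos.2 hmax
  have hkle : ∀ t ∈ Icc 0 T, |ε * h t| ≤ δ (u t) := by
    intro t ht
    rw [abs_mul, abs_of_pos hε0, hε, inv_mul_le_iff₀ hmax]
    exact (hC t ht).trans (mul_le_mul_of_nonneg_right (le_max_left _ _) (hδ0 _))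
  have hk1 : ∀ᵐ t ∂(volume.restrict (Icc 0 T)), |ε * h t| ≤ 1 - |u t| := by
    filter_upwards [hu1, ae_restrict_mem measurableSet_Icc] with t ht hmem
    exact (hkle t hmem).trans ((hδle _).trans (hle _ ht))
  have hopt := hu.integral_runningCost_le hT (k := fun t => ε * h t) (C := 1) (hm.const_mul ε)
    (hk1.mono fun t ht => ht.trans (by linarith [abs_nonneg (u t)]))
    (fun i => by simp only [mul_left_comm _ ε, integral_const_mul, hh0, Pi.zero_apply, mul_zero])
    (hk1.mono fun t ht => (abs_add_le _ _).trans (by linarith))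
  have hcost : ∫ t in Icc 0 T, runningCost U w (u t + ε * h t) =
      ∫ t in Icc 0 T, (runningCost U w (u t) + s * ε * h t) := by
    refine setIntegral_congr_fun measurableSet_Icc fun t ht => ?_
    have hkt := hkle t ht
    rw [runningCost_add (hkt.trans (hδle _))]
    by_cases hst : runningCostSlope U w (u t) = s
    · rw [hst, mul_assoc]
    · rw [hδ, indicator_of_notMem (by exact hst)] at hkt
      have h0 : ε * h t = 0 := abs_nonpos_iff.1 hkt
      rw [mul_assoc, h0, mul_zero, mul_zero]
  have hhi : Integrable h (volume.restrict (Icc 0 T)) := by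
    refine (hdi.const_mul C).mono' hm.aestronglyMeasurable ?_
    filter_upwards [ae_restrict_mem measurableSet_Icc] with t ht using hC t ht
  rw [hcost, integral_add (integrable_runningCost hum hu1) (hhi.const_mul _), integral_const_mul,
    hhs] at hopt
  have : 0 < s ^ 2 * ε := by positivity
  linarith

lemma IsSOAVOptimal.ae_mem_alphabet_of_lt (hA : A.det ≠ 0) (hAB : IsControllable A B)
    (hU : ∀ i, 0 ≤ U i) (hU_last : U (Fin.last m) = 1)
    (hw_pos : ∀ i, i ≠ Fin.last m → 0 < w i) (hT : 0 ≤ T) (hu : IsSOAVOptimal A B U w T ξ u) :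
    ∀ᵐ t ∂(volume.restrict (Icc 0 T)), U 0 < |u t| → u t ∈ alphabet U := by
  have h : ∀ᵐ t ∂(volume.restrict (Icc 0 T)), ∀ s ∈ range (runningCostSlope U w) \ {0},
      runningCostSlope U w (u t) = s → u t ∈ alphabet U :=
    (ae_ball_iff ((finite_range_runningCostSlope U w).subset sdiff_subset).countable).2
      fun s hs => hu.ae_mem_alphabet_of_slope_eq hA hAB hU_last hT hs.2
  filter_upwards [h, ae_abs_le_one_of_linftyNorm_le hu.1.2.1] with t ht ht1 hlt
  by_contra hmem
  exact hmem (ht _ ⟨⟨u t, rfl⟩, runningCostSlope_ne_zero hU hU_last hw_pos hmem ht1 hlt⟩ rfl)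

/-- On the set where `|u| < U 0` the control may be varied at no cost. If this set has positive
measure, such variations reach every state, so they can compensate for shrinking `u` on the set
where `|u| > U 0`, which lowers the cost there. -/
lemma IsSOAVOptimal.ae_abs_le (hA : A.det ≠ 0) (hAB : IsControllable A B)
    (hU_nonneg : 0 ≤ U 0) (hU_mono : StrictMono U) (hU_last : U (Fin.last m) = 1)
    (hw_pos : ∀ i, i ≠ Fin.last m → 0 < w i) (hT : 0 ≤ T) (hu : IsSOAVOptimal A B U w T ξ u)
    (hlow : ¬ ∀ᵐ t ∂(volume.restrict (Icc 0 T)), ¬ |u t| < U 0) :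
    ∀ᵐ t ∂(volume.restrict (Icc 0 T)), |u t| ≤ U 0 := by
  have hum := hu.1.1
  have hu1 := ae_abs_le_one_of_linftyNorm_le hu.1.2.1
  have hU (i : Fin (m + 1)) : 0 ≤ U i := hU_nonneg.trans (hU_mono.monotone (Fin.zero_le i))
  have hU0 : U 0 ≤ 1 := hU_last ▸ hU_mono.monotone (Fin.zero_le _)
  set d : ℝ → ℝ := fun t => max (U 0 - |u t|) 0 with hd
  have hd0 (t : ℝ) : 0 ≤ d t := le_max_right _ _
  have hdm : AEMeasurable d (volume.restrict (Icc 0 T)) :=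
    (aemeasurable_const.sub (continuous_abs.measurable.comp_aemeasurable hum)).max
      aemeasurable_const
  have hd1 (t : ℝ) : d t ≤ 1 := max_le (by linarith [abs_nonneg (u t)]) zero_le_one
  have hdi : Integrable d (volume.restrict (Icc 0 T)) :=
    Integrable.of_bound hdm.aestronglyMeasurable 1
      (ae_of_all _ fun t => by rw [Real.norm_of_nonneg (hd0 t)]; exact hd1 t)
  have hdpos : ¬ ∀ᵐ t ∂(volume.restrict (Icc 0 T)), ¬ d t ≠ 0 := by
    refine fun h => hlow (h.mono fun t ht hlt => ht (ne_of_gt ?_))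
    exact lt_max_of_lt_left (sub_pos.2 hlt)
  set φ : ℝ → ℝ := {v | U 0 < |v|}.indicator (fun v => -v) with hφ
  have hφm : Measurable φ := measurable_neg.indicator
    (measurableSet_lt measurable_const continuous_abs.measurable)
  have hφle (v : ℝ) : |φ v| ≤ |v| := by
    simpa [hφ] using norm_indicator_le_norm_self (s := {v : ℝ | U 0 < |v|}) (fun v : ℝ => -v) v
  have hgi : Integrable (fun t => φ (u t)) (volume.restrict (Icc 0 T)) :=
    Integrable.of_bound (hφm.comp_aemeasurable hum).aestronglyMeasurable 1
      (hu1.mono fun t ht => (hφle _).trans ht)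
  obtain ⟨h, hm, ⟨C, hC⟩, hh0, -⟩ := exists_variation hA hAB hd0 hdi hdpos
    (fun i => -∫ t in Icc 0 T, inputKernel A B t i * φ (u t)) 0
  have hhi : Integrable h (volume.restrict (Icc 0 T)) := by
    refine (hdi.const_mul C).mono' hm.aestronglyMeasurable ?_
    filter_upwards [ae_restrict_mem measurableSet_Icc] with t ht using hC t ht
  have hbi (i : Fin n) {f : ℝ → ℝ} (hf : Integrable f (volume.restrict (Icc 0 T))) :
      Integrable (fun t => inputKernel A B t i * f t) (volume.restrict (Icc 0 T)) :=
    IntegrableOn.continuousOn_mul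
      ((continuous_apply i).comp (continuous_inputKernel A B)).continuousOn hf isCompact_Icc
  -- Scaling by `ε` brings `|h| ≤ C * d` below the weight itself, and `ε ≤ 1`.
  set ε : ℝ := (max C 1)⁻¹ with hε
  have hmax : 0 < max C 1 := lt_max_of_lt_right one_pos
  have hε0 : 0 < ε := inv_pos.2 hmax
  have hε1 : ε ≤ 1 := inv_le_one_of_one_le₀ (le_max_right _ _)
  have hhle : ∀ t ∈ Icc 0 T, |ε * h t| ≤ d t := by
    intro t ht
    rw [abs_mul, abs_of_pos hε0, hε, inv_mul_le_iff₀ hmax]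
    exact (hC t ht).trans (mul_le_mul_of_nonneg_right (le_max_left _ _) (hd0 _))
  set k : ℝ → ℝ := fun t => ε * (φ (u t) + h t) with hk
  have hkm : AEMeasurable k (volume.restrict (Icc 0 T)) :=
    ((hφm.comp_aemeasurable hum).add hm).const_mul ε
  have hk0 (i : Fin n) : ∫ t in Icc 0 T, inputKernel A B t i * k t = 0 := by
    simp only [hk, mul_left_comm _ ε, integral_const_mul]
    simp only [mul_add (inputKernel A B _ i)]
    rw [integral_add (hbi i hgi) (hbi i hhi), hh0, add_neg_cancel, mul_zero]
  -- Below the level the variation is `ε * h`, above the level it is `-ε * u`.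
  have hkle : ∀ t ∈ Icc 0 T, |u t| ≤ U 0 → |u t + k t| ≤ U 0 := by
    intro t ht hle
    have h1 : φ (u t) = 0 := indicator_of_notMem (by simpa using hle) _
    have h2 := hhle t ht
    simp only [hd] at h2
    rw [max_eq_left (by linarith)] at h2
    simp only [hk, h1, zero_add]
    linarith [abs_add_le (u t) (ε * h t)]
  have hkgt : ∀ t ∈ Icc 0 T, U 0 < |u t| → |u t + k t| < |u t| := by
    intro t ht hlt
    have h1 : φ (u t) = -u t := indicator_of_mem (by exact hlt) _
    have h2 := hhle t ht
    simp only [hd] at h2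
    rw [max_eq_right (by linarith)] at h2
    have h3 : ε * h t = 0 := abs_nonpos_iff.1 h2
    have h4 : u t + k t = (1 - ε) * u t := by
      simp only [hk, h1, mul_add, h3]
      ring
    rw [h4, abs_mul, abs_of_nonneg (by linarith)]
    have := mul_pos hε0 (hU_nonneg.trans_lt hlt)
    linarith
  have huk : ∀ᵐ t ∂(volume.restrict (Icc 0 T)), |u t + k t| ≤ 1 := by
    filter_upwards [hu1, ae_restrict_mem measurableSet_Icc] with t ht hmem
    rcases le_or_gt |u t| (U 0) with hle | hlt
    · exact (hkle t hmem hle).trans hU0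
    · exact (hkgt t hmem hlt).le.trans ht
  have hkC : ∀ᵐ t ∂(volume.restrict (Icc 0 T)), |k t| ≤ 2 := by
    filter_upwards [hu1, huk] with t ht ht'
    have := abs_sub (u t + k t) (u t)
    rw [add_sub_cancel_left] at this
    linarith
  have hopt := hu.integral_runningCost_le hT hkm hkC hk0 huk
  have hcost : (fun t => runningCost U w (u t + k t)) ≤ᵐ[volume.restrict (Icc 0 T)]
      fun t => runningCost U w (u t) := by
    filter_upwards [hu1, ae_restrict_mem measurableSet_Icc] with t ht hmem
    rcases le_or_gt |u t| (U 0) with hle | hlt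
    · exact (runningCost_eq_runningCost_of_abs_le hU_mono hU_nonneg (hkle t hmem hle) hle).le
    · exact runningCost_le_runningCost hU hU_last hw_pos (hkgt t hmem hlt).le ht
  have heq := (integral_eq_iff_of_ae_le (integrable_runningCost (hum.add hkm) huk)
    (integrable_runningCost hum hu1) hcost).1 (le_antisymm
      (integral_mono_ae (integrable_runningCost (hum.add hkm) huk)
        (integrable_runningCost hum hu1) hcost) hopt)
  filter_upwards [heq, hu1, ae_restrict_mem measurableSet_Icc] with t ht ht1 hmem
  by_contra! hlt
  exact (runningCost_lt_runningCost hU hU_last hw_pos (hkgt t hmem hlt) ht1 hlt).ne ht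

end Optimal

theorem theorem2 {n m : ℕ} (A : Matrix (Fin n) (Fin n) ℝ) (B : Fin n → ℝ)
    (hA : A.det ≠ 0) (hAB : IsControllable A B)
    (U w : Fin (m + 1) → ℝ)
    (hU_nonneg : 0 ≤ U 0) (hU_mono : StrictMono U) (hU_last : U (Fin.last m) = 1)
    (hw_pos : ∀ i, i ≠ Fin.last m → 0 < w i) (hw_sum : ∑ i, w i = 1)
    (T : ℝ) (hT : 0 < T) (ξ : Fin n → ℝ)
    (u : ℝ → ℝ) (hu : IsSOAVOptimal A B U w T ξ u) :
    ((∀ᵐ t ∂(volume.restrict (Icc 0 T)), u t ∈ alphabet U) ∨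
      linftyNorm T u ≤ ENNReal.ofReal (U 0)) ∧
    (U 0 = 0 → ∀ᵐ t ∂(volume.restrict (Icc 0 T)), u t ∈ alphabet U) := by
  have hU (i : Fin (m + 1)) : 0 ≤ U i := hU_nonneg.trans (hU_mono.monotone (Fin.zero_le i))
  have habove := hu.ae_mem_alphabet_of_lt hA hAB hU hU_last hw_pos hT.le
  have hmem (hlow : ∀ᵐ t ∂(volume.restrict (Icc 0 T)), ¬ |u t| < U 0) :
      ∀ᵐ t ∂(volume.restrict (Icc 0 T)), u t ∈ alphabet U := by
    filter_upwards [habove, hlow] with t h1 h2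
    rcases (not_lt.1 h2).lt_or_eq with h | h
    · exact h1 h
    · exact ⟨0, (abs_eq hU_nonneg).1 h.symm⟩
  refine ⟨?_, fun h0 => hmem (ae_of_all _ fun t => by simp [h0])⟩
  by_cases hlow : ∀ᵐ t ∂(volume.restrict (Icc 0 T)), ¬ |u t| < U 0
  · exact Or.inl (hmem hlow)
  · exact Or.inr (linftyNorm_le_ofReal
      (hu.ae_abs_le hA hAB hU_nonneg hU_mono hU_last hw_pos hT.le hlow))
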